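/- Let $d,N\ge 1$ be integers and let $\mathbb{R}^N_+=\{v\in\mathbb{R}^N: v_i\ge 0 \text{ for } i=1,\dots,N\}$, ordered component-wise ($v\le w$ if $v_i\le w_i$ for all $i$). For a Lebesgue measurable set $E\subset\mathbb{R}^d$ let $|E|$ be its Lebesgue measure and $$P(E)=\sup\Big\{\int_E \operatorname{div}T\,dx : T\in C^1_c(\mathbb{R}^d;\mathbb{R}^d),\ |T|\le 1\Big\}\in[0,\infty]$$ its Euclidean perimeter. An $N$-cluster of a set $F\subset\mathbb{R}^d$ is an $N$-tuple $\mathcal E=(\mathcal E_1,\dots,\mathcal E_N)$ of Lebesgue measurable sets such that, for all $i\ne j$, $|\mathcal E_i\setminus F|=0$, $|\mathcal E_i|>0$, $P(\mathcal E_i)<\infty$ and $|\mathcal E_i\cap\mathcal E_j|=0$ (the conditions on $\mathcal E_i$ alone being required for every $i=1,\dots,N$). **Theorem (Existence of minimizers of $H^{\Phi,N}(\Omega)$).** Let $\Phi\colon\mathbb{R}^N_+\to[0,\infty)$ be lower semicontinuous, coercive (there is $\delta>0$ such that $\Phi(v)\ge\delta\|v\|_1=\delta\sum_{i=1}^N v_i$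 for all $v\in\mathbb{R}^N_+$) and increasing ($\Phi(v)\le\Phi(w)$ for all $v,w\in\mathbb{R}^N_+$ with $v\le w$). Let $\Omega\subset\mathbb{R}^d$ be a bounded, open and nonempty set. Then there exists a $\Phi$-Cheeger $N$-cluster of $\Omega$, that is, an $N$-cluster $\mathcal E$ of $\Omega$ such that $$\Phi\left(\frac{P(\mathcal E_1)}{|\mathcal E_1|},\dots,\frac{P(\mathcal E_N)}{|\mathcal E_N|}\right)=H^{\Phi,N}(\Omega):=\inf\left\{\Phi\left(\frac{P(\mathcal F_1)}{|\mathcal F_1|},\dots,\frac{P(\mathcal F_N)}{|\mathcal F_N|}\right):\mathcal F\ \text{is an } N\text{-cluster of }\Omega\right\}.$$ -/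

import Mathlib

open MeasureTheory
open scoped NNReal ENNReal

namespace NCheeger

noncomputable section

/-- The divergence `∑ i, ∂ T_i / ∂ x_i` of a vector field on `ℝ^d`. -/
def divergence {d : ℕ} (T : EuclideanSpace ℝ (Fin d) → EuclideanSpace ℝ (Fin d))
    (x : EuclideanSpace ℝ (Fin d)) : ℝ :=
  ∑ i : Fin d, (fderiv ℝ T x (EuclideanSpace.single i 1)) i

/-- The admissible test fields in the definition of the perimeter: `T ∈ C¹_c(ℝ^d; ℝ^d)` with
`|T| ≤ 1` everywhere, for the Euclidean norm. -/
structure IsTestField {d : ℕ} (T : EuclideanSpace ℝ (Fin d) → EuclideanSpace ℝ (Fin d)) :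
    Prop where
  contDiff : ContDiff ℝ 1 T
  hasCompactSupport : HasCompactSupport T
  norm_le_one : ∀ x, ‖T x‖ ≤ 1

/-- The (De Giorgi) Euclidean perimeter of a set `E ⊆ ℝ^d`,
`P(E) = sup {∫_E div T : T ∈ C¹_c(ℝ^d; ℝ^d), |T| ≤ 1}`, with values in `[0, ∞]`. The supremum is
nonnegative because of `T = 0`, so that cutting negative integrals off at `0` does not change
it. -/
def perimeter {d : ℕ} (E : Set (EuclideanSpace ℝ (Fin d))) : ℝ≥0∞ :=
  ⨆ (T : EuclideanSpace ℝ (Fin d) → EuclideanSpace ℝ (Fin d)) (_ : IsTestField T),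
    ENNReal.ofReal (∫ x in E, divergence T x)

/-- `E = (E_1, …, E_N)` is an `N`-set of `F ⊆ ℝ^d`: the chambers `E_i` are Lebesgue measurable,
contained in `F` up to a null set, of positive Lebesgue measure, and pairwise disjoint up to
null sets. -/
structure IsNSet {d N : ℕ} (E : Fin N → Set (EuclideanSpace ℝ (Fin d)))
    (F : Set (EuclideanSpace ℝ (Fin d))) : Prop where
  nullMeasurableSet : ∀ i, NullMeasurableSet (E i) volume
  subset : ∀ i, volume (E i \ F) = 0
  volume_pos : ∀ i, 0 < volume (E i)
  disjoint : ∀ i j, i ≠ j → volume (E i ∩ E j) = 0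

/-- `E` is an `N`-cluster of `F`: an `N`-set of `F` all of whose chambers have finite perimeter. -/
structure IsNCluster {d N : ℕ} (E : Fin N → Set (EuclideanSpace ℝ (Fin d)))
    (F : Set (EuclideanSpace ℝ (Fin d))) : Prop extends IsNSet E F where
  perimeter_lt_top : ∀ i, perimeter (E i) < ∞

/-- The vector `P(E) / |E| = (P(E_1) / |E_1|, …, P(E_N) / |E_N|) ∈ ℝ^N_+`. The ratios are finite
whenever `E` is an `N`-cluster. -/
def ratios {d N : ℕ} (E : Fin N → Set (EuclideanSpace ℝ (Fin d))) : Fin N → ℝ≥0 :=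
  fun i => (perimeter (E i) / volume (E i)).toNNReal

/-- The `(Φ, N)`-Cheeger constant `H^{Φ,N}(F) ∈ [0, ∞]`: the infimum of `Φ(P(E) / |E|)` over all
`N`-clusters `E` of `F`. -/
def cheegerConstant {d N : ℕ} (Φ : (Fin N → ℝ≥0) → ℝ≥0)
    (F : Set (EuclideanSpace ℝ (Fin d))) : ℝ≥0∞ :=
  ⨅ (E : Fin N → Set (EuclideanSpace ℝ (Fin d))) (_ : IsNCluster E F), (Φ (ratios E) : ℝ≥0∞)

/-- A `Φ`-Cheeger `N`-cluster of `F`: an `N`-cluster of `F` that achieves the infimum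
`H^{Φ,N}(F)`. -/
structure IsCheegerNCluster {d N : ℕ} (Φ : (Fin N → ℝ≥0) → ℝ≥0)
    (E : Fin N → Set (EuclideanSpace ℝ (Fin d))) (F : Set (EuclideanSpace ℝ (Fin d))) :
    Prop extends IsNCluster E F where
  minimal : (Φ (ratios E) : ℝ≥0∞) = cheegerConstant Φ F

/-- `Φ : ℝ^N_+ → [0, ∞)` is coercive: there is `δ > 0` with `Φ(v) ≥ δ ‖v‖₁` for all `v ∈ ℝ^N_+`.
The `1`-norm of a vector with nonnegative entries is the sum of the entries. -/
def Coercive {N : ℕ} (Φ : (Fin N → ℝ≥0) → ℝ≥0) : Prop :=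
  ∃ δ : ℝ≥0, 0 < δ ∧ ∀ v, δ * ∑ i, v i ≤ Φ v

end

end NCheeger

open Set Filter Topology
open scoped symmDiff

namespace NCheeger

/-! The proof is the direct method. Coercivity bounds the ratios of a minimizing sequence, so a
subsequence of them converges to some `v`. The chambers lie in the bounded set `Ω`, so their
perimeters are bounded too, and a further subsequence converges in measure to sets `F i`. Perimeter
is lower semicontinuous and volume is continuous, hence `ratios F ≤ v`. Monotonicity and lower
semicontinuity of `Φ` then give `Φ (ratios F) ≤ Φ v ≤ H`. The limit is a cluster only if no chamber
loses all its volume.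

Both compactness and this lower volume bound come from one estimate, `|E \ (E - v)| ≤ ‖v‖ P(E)`
(`volume_inter_translate_compl_le`). Averaged over `‖v‖ ≤ R`, it bounds the integral over `E` of
`|B(x, R) \ E|`, and the same integral with `E` and its complement exchanged. For `R` of the order
of the inverse ratio, this forces `|E|` to be comparable to `|B_R|`
(`volume_closedBall_le_two_mul`). For small `R`, it shows that `E` is close to a union of grid
cells, of which only finitely many matter (`exists_finite_discretization`); this is total
boundedness in `L¹`. -/

/-! ### Test fields and directional derivatives -/

theorem continuous_divergence {d : ℕ} {T : EuclideanSpace ℝ (Fin d) → EuclideanSpace ℝ (Fin d)}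
    (hT : ContDiff ℝ 1 T) : Continuous (divergence T) := by
  have h := hT.continuous_fderiv one_ne_zero
  unfold divergence
  fun_prop

theorem hasCompactSupport_divergence {d : ℕ}
    {T : EuclideanSpace ℝ (Fin d) → EuclideanSpace ℝ (Fin d)}
    (hT : HasCompactSupport T) : HasCompactSupport (divergence T) := by
  refine (hT.fderiv (𝕜 := ℝ)).mono fun x hx => ?_
  contrapose! hx
  simp only [Function.mem_support, not_not] at hx ⊢
  simp [divergence, hx]

theorem IsTestField.ofReal_integral_le {d : ℕ}
    {T : EuclideanSpace ℝ (Fin d) → EuclideanSpace ℝ (Fin d)} (hT : IsTestField T)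
    (E : Set (EuclideanSpace ℝ (Fin d))) :
    ENNReal.ofReal (∫ x in E, divergence T x) ≤ perimeter E :=
  le_iSup₂ (f := fun T (_ : IsTestField T) => ENNReal.ofReal (∫ x in E, divergence T x)) T hT

theorem IsTestField.integral_le {d : ℕ}
    {T : EuclideanSpace ℝ (Fin d) → EuclideanSpace ℝ (Fin d)} (hT : IsTestField T)
    {E : Set (EuclideanSpace ℝ (Fin d))} (hE : perimeter E ≠ ∞) :
    ∫ x in E, divergence T x ≤ (perimeter E).toReal :=
  (ENNReal.ofReal_le_iff_le_toReal hE).1 (hT.ofReal_integral_le E)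

theorem perimeter_congr_ae {d : ℕ} {E F : Set (EuclideanSpace ℝ (Fin d))}
    (h : E =ᵐ[volume] F) : perimeter E = perimeter F := by
  simp only [perimeter, setIntegral_congr_set h]

theorem divergence_smul_const {d : ℕ} {φ : EuclideanSpace ℝ (Fin d) → ℝ}
    {x : EuclideanSpace ℝ (Fin d)} (hφ : DifferentiableAt ℝ φ x)
    (v : EuclideanSpace ℝ (Fin d)) :
    divergence (fun y => φ y • v) x = fderiv ℝ φ x v := by
  have h1 : fderiv ℝ (fun y => φ y • v) x = (fderiv ℝ φ x).smulRight v := by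
    rw [fderiv_smul_const hφ]
  have h2 : v = ∑ i, v i • EuclideanSpace.single i (1 : ℝ) := by
    simpa using ((EuclideanSpace.basisFun (Fin d) ℝ).sum_repr v).symm
  conv_rhs => rw [h2, map_sum]
  simp [divergence, h1, mul_comm]

/-- Testing the perimeter with `φ • v` for a scalar function `φ`. -/
theorem setIntegral_fderiv_le {d : ℕ} {E : Set (EuclideanSpace ℝ (Fin d))}
    (hE : perimeter E ≠ ∞) {φ : EuclideanSpace ℝ (Fin d) → ℝ} (hφ : ContDiff ℝ 1 φ)
    (hc : HasCompactSupport φ) (h1 : ∀ x, |φ x| ≤ 1) (v : EuclideanSpace ℝ (Fin d)) :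
    ∫ x in E, fderiv ℝ φ x v ≤ ‖v‖ * (perimeter E).toReal := by
  rcases eq_or_ne v 0 with rfl | hv
  · simp
  have hv' : ‖v‖ ≠ 0 := norm_ne_zero_iff.2 hv
  have hT : IsTestField (fun y => φ y • (‖v‖⁻¹ • v)) := by
    refine ⟨by fun_prop, hc.smul_right, fun x => ?_⟩
    rw [norm_smul, norm_smul, norm_inv, norm_norm, inv_mul_cancel₀ hv', mul_one]
    exact h1 x
  have := hT.integral_le hE
  simp only [divergence_smul_const (hφ.differentiable one_ne_zero _), map_smul, smul_eq_mul,
    integral_const_mul] at this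
  rwa [inv_mul_le_iff₀ (by positivity)] at this

/-! ### The translation estimate -/

/-- Translates of `φ` are equally admissible, so the derivative in `t` of `∫_E φ(x + t v)` is at
most `‖v‖ P(E)` for every `t`; the mean value inequality on `[0, 1]` concludes. -/
theorem integral_translate_sub_le {d : ℕ} {E : Set (EuclideanSpace ℝ (Fin d))}
    (hE : perimeter E ≠ ∞) (hfin : volume E ≠ ∞)
    {φ : EuclideanSpace ℝ (Fin d) → ℝ} (hφ : ContDiff ℝ 1 φ)
    (hc : HasCompactSupport φ) (h1 : ∀ x, |φ x| ≤ 1) (v : EuclideanSpace ℝ (Fin d)) :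
    (∫ x in E, φ (x + v)) - ∫ x in E, φ x ≤ ‖v‖ * (perimeter E).toReal := by
  have hcd := hφ.continuous_fderiv one_ne_zero
  obtain ⟨C, hC⟩ := (hc.fderiv (𝕜 := ℝ)).exists_bound_of_continuous hcd
  have hfm : IsFiniteMeasure (volume.restrict E) := ⟨by simpa using hfin.lt_top⟩
  have key : ∀ t : ℝ, HasDerivAt (fun t : ℝ => ∫ x in E, φ (x + t • v))
      (∫ x in E, fderiv ℝ φ (x + t • v) v) t := by
    intro t
    refine (hasDerivAt_integral_of_dominated_loc_of_deriv_le (s := univ)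
      (bound := fun _ => C * ‖v‖) (F := fun (t : ℝ) x => φ (x + t • v))
      (F' := fun (t : ℝ) x => fderiv ℝ φ (x + t • v) v) univ_mem ?_ ?_ ?_ ?_ ?_ ?_).2
    · exact Eventually.of_forall fun t =>
        (hφ.continuous.comp (by fun_prop)).aestronglyMeasurable
    · refine Integrable.of_bound (hφ.continuous.comp (by fun_prop)).aestronglyMeasurable 1 ?_
      exact Eventually.of_forall fun x => h1 _
    · exact Continuous.aestronglyMeasurable (by fun_prop)
    · exact Eventually.of_forall fun x t _ =>
        (ContinuousLinearMap.le_opNorm _ _).trans (by gcongr; exact hC _)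
    · exact integrable_const _
    · refine Eventually.of_forall fun x t _ => ?_
      have h2 : HasDerivAt (fun t : ℝ => x + t • v) v t := by
        simpa using ((hasDerivAt_id t).smul_const v).const_add x
      exact ((hφ.differentiable one_ne_zero _).hasFDerivAt).comp_hasDerivAt t h2
  have h := image_sub_le_mul_sub_of_deriv_le (C := ‖v‖ * (perimeter E).toReal)
    (fun t => (key t).differentiableAt) (fun t => ?_) zero_le_one
  · simpa only [one_smul, zero_smul, add_zero, sub_zero, mul_one] using h
  · rw [(key t).deriv]
    have h3 := setIntegral_fderiv_le hE (φ := fun x => φ (x + t • v)) (by fun_prop)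
      (hc.comp_homeomorph (Homeomorph.addRight (t • v))) (fun x => h1 _) v
    simpa [fderiv_comp_add_right] using h3

/-- Sets of finite perimeter move little under translations: `|E \ (E - v)| ≤ ‖v‖ P(E)`. -/
theorem volume_inter_translate_compl_le {d : ℕ} {E : Set (EuclideanSpace ℝ (Fin d))}
    (hm : MeasurableSet E) (hfin : volume E ≠ ∞) (v : EuclideanSpace ℝ (Fin d)) :
    volume {x | x ∈ E ∧ x + v ∈ Eᶜ} ≤ ENNReal.ofReal ‖v‖ * perimeter E := by
  rcases eq_or_ne v 0 with rfl | hv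
  · simp
  rcases eq_or_ne (perimeter E) ∞ with hE | hE
  · simp [hE, ENNReal.mul_top, hv]
  have hset : {x | x ∈ E ∧ x + v ∈ Eᶜ} = (fun x => x + v) ⁻¹' (((fun x => x + -v) ⁻¹' E) \ E) := by
    ext x; simp
  have hmv : MeasurableSet ((fun x => x + -v) ⁻¹' E) := hm.preimage (by fun_prop)
  rw [hset, measure_preimage_add_right]
  refine le_of_forall_lt fun c hcl => ?_
  -- The test function approximates the indicator of `(E + v) \ E`: it is `1` on a compact `K`
  -- inside this set and vanishes off a slightly larger open `U`. Then `∫_E φ(x + v) ≥ |K|`, because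
  -- `K ⊆ E + v`, and `∫_E φ ≤ |U \ K|`, because `K` misses `E`.
  obtain ⟨K, hKs, hK, hcK⟩ := (hmv.diff hm).exists_lt_isCompact hcl
  refine hcK.trans_le ?_
  have hKfin : volume K ≠ ∞ := hK.measure_lt_top.ne
  refine ENNReal.le_of_forall_pos_le_add fun ε hε _ => ?_
  obtain ⟨U₀, hKU₀, hU₀, hUε⟩ := K.exists_isOpen_lt_add hKfin (ENNReal.coe_pos.2 hε).ne'
  obtain ⟨B, hKB⟩ := hK.isBounded.subset_ball 0
  set U := U₀ ∩ Metric.ball 0 B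
  have hU : IsOpen U := hU₀.inter Metric.isOpen_ball
  have hKU : K ⊆ U := subset_inter hKU₀ hKB
  have hUK : volume (U \ K) ≤ ε := by
    rw [measure_sdiff hKU hK.measurableSet.nullMeasurableSet hKfin]
    exact tsub_le_iff_left.2 ((measure_mono inter_subset_left).trans hUε.le)
  obtain ⟨φ, hφ, hφr, hφs, hφ1⟩ := exists_contMDiff_support_eq_eq_one_iff (n := 1)
    (modelWithCornersSelf ℝ (EuclideanSpace ℝ (Fin d))) hU hK.isClosed hKU
  have hφ' : ContDiff ℝ 1 φ := hφ.contDiff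
  have h01 : ∀ x, φ x ∈ Icc (0 : ℝ) 1 := fun x => hφr (mem_range_self x)
  have habs : ∀ x, |φ x| ≤ 1 := fun x => abs_le.2 ⟨by linarith [(h01 x).1], (h01 x).2⟩
  have hsupp : HasCompactSupport φ := by
    refine HasCompactSupport.intro (isCompact_closedBall (0 : EuclideanSpace ℝ (Fin d)) B)
      fun x hx => ?_
    by_contra hne
    have : x ∈ U := hφs ▸ hne
    exact hx (Metric.ball_subset_closedBall this.2)
  have hint : Integrable φ := hφ'.continuous.integrable_of_hasCompactSupport hsupp
  have hle := integral_translate_sub_le hE hfin hφ' hsupp habs v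
  have hUKfin : volume (U \ K) ≠ ∞ := ne_top_of_le_ne_top ENNReal.coe_ne_top hUK
  have hlow : volume.real K ≤ ∫ x in E, φ (x + v) := by
    have h2 : ∫ x in E, φ (x + v) = ∫ x in (fun x => x + -v) ⁻¹' E, φ x := by
      rw [← (measurePreserving_add_right volume v).setIntegral_preimage_emb
        (measurableEmbedding_addRight v) φ ((fun x => x + -v) ⁻¹' E)]
      congr 2
      ext x; simp
    rw [h2]
    calc volume.real K = ∫ x in K, φ x := by
          rw [setIntegral_congr_fun (g := fun _ => (1 : ℝ)) hK.measurableSet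
            fun x hx => (hφ1 x).1 hx]
          simp
      _ ≤ _ := setIntegral_mono_set hint.integrableOn
          (Eventually.of_forall fun x => (h01 x).1)
          (hKs.trans sdiff_subset).eventuallyLE
  have hup : ∫ x in E, φ x ≤ volume.real (U \ K) := by
    calc ∫ x in E, φ x ≤ ∫ x in E, (U \ K).indicator (fun _ => (1 : ℝ)) x := by
          refine setIntegral_mono_on hint.integrableOn ?_ hm fun x hx => ?_
          · exact ((integrable_indicator_iff (hU.measurableSet.diff hK.measurableSet)).2
              (integrableOn_const hUKfin)).integrableOn
          · by_cases hxU : x ∈ U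
            · have : x ∈ U \ K := ⟨hxU, fun hxK => (hKs hxK).2 hx⟩
              simpa [indicator_of_mem this] using (h01 x).2
            · have : φ x = 0 := by
                by_contra hne
                exact hxU (hφs ▸ hne)
              rw [this]
              exact indicator_nonneg (fun _ _ => zero_le_one) x
      _ ≤ ∫ x, (U \ K).indicator (fun _ => (1 : ℝ)) x := by
          refine setIntegral_le_integral ?_
            (Eventually.of_forall (indicator_nonneg (fun _ _ => zero_le_one)))
          exact (integrable_indicator_iff (hU.measurableSet.diff hK.measurableSet)).2
              (integrableOn_const hUKfin)
      _ = volume.real (U \ K) := by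
          rw [integral_indicator (hU.measurableSet.diff hK.measurableSet)]; simp
  have hfinal : volume.real K ≤ ‖v‖ * (perimeter E).toReal + volume.real (U \ K) :=
    (hlow.trans (sub_le_iff_le_add.1 hle)).trans (by gcongr)
  calc volume K = ENNReal.ofReal (volume.real K) := (ENNReal.ofReal_toReal hKfin).symm
    _ ≤ ENNReal.ofReal (‖v‖ * (perimeter E).toReal + volume.real (U \ K)) :=
        ENNReal.ofReal_le_ofReal hfinal
    _ = ENNReal.ofReal ‖v‖ * perimeter E + volume (U \ K) := by
        rw [ENNReal.ofReal_add (by positivity) (by positivity),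
          ENNReal.ofReal_mul (norm_nonneg _), ENNReal.ofReal_toReal hE, Measure.real,
          ENNReal.ofReal_toReal hUKfin]
    _ ≤ _ := by gcongr

/-! ### Averaging over balls and the weak isoperimetric inequality -/

/-- Tonelli: `|B(x, R) ∩ B|` is the integral over `‖v‖ ≤ R` of the indicator of `B` at `x + v`, and
exchanging the integrals leaves the volumes bounded in `h`. -/
theorem lintegral_volume_closedBall_inter_le {d : ℕ} {A B : Set (EuclideanSpace ℝ (Fin d))}
    (hB : MeasurableSet B) {P : ℝ≥0∞}
    (h : ∀ v, volume {x | x ∈ A ∧ x + v ∈ B} ≤ ENNReal.ofReal ‖v‖ * P) (R : ℝ) :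
    ∫⁻ x in A, volume (Metric.closedBall x R ∩ B) ≤
      volume (Metric.closedBall (0 : EuclideanSpace ℝ (Fin d)) R) * (ENNReal.ofReal R * P) := by
  have h1 : ∀ x : EuclideanSpace ℝ (Fin d), volume (Metric.closedBall x R ∩ B) =
      ∫⁻ v in Metric.closedBall 0 R, B.indicator 1 (x + v) := by
    intro x
    have : Metric.closedBall x R ∩ B = (fun v => -x + v) ⁻¹'
        (Metric.closedBall 0 R ∩ (fun v => x + v) ⁻¹' B) := by
      ext y
      simp [dist_eq_norm, neg_add_eq_sub]
    have hBx : MeasurableSet ((fun v => x + v) ⁻¹' B) := hB.preimage (by fun_prop)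
    rw [this, measure_preimage_add, inter_comm, ← Measure.restrict_apply hBx,
      ← lintegral_indicator_one hBx]
    rfl
  have hmeas : Measurable (fun p : EuclideanSpace ℝ (Fin d) × EuclideanSpace ℝ (Fin d) =>
      B.indicator (1 : EuclideanSpace ℝ (Fin d) → ℝ≥0∞) (p.1 + p.2)) :=
    (measurable_one.indicator hB).comp (measurable_fst.add measurable_snd)
  simp_rw [h1]
  rw [lintegral_lintegral_swap hmeas.aemeasurable]
  calc ∫⁻ v in Metric.closedBall 0 R, ∫⁻ x in A, B.indicator 1 (x + v)
      ≤ ∫⁻ v in Metric.closedBall (0 : EuclideanSpace ℝ (Fin d)) R, ENNReal.ofReal R * P := by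
        refine setLIntegral_mono measurable_const fun v hv => ?_
        have hBv : MeasurableSet ((fun x => x + v) ⁻¹' B) := hB.preimage (by fun_prop)
        have : ∫⁻ x in A, B.indicator 1 (x + v) = volume {x | x ∈ A ∧ x + v ∈ B} := by
          have e : {x | x ∈ A ∧ x + v ∈ B} = (fun x => x + v) ⁻¹' B ∩ A := by
            ext; simp [and_comm]
          rw [e, ← Measure.restrict_apply hBv, ← lintegral_indicator_one hBv]
          rfl
        rw [this]
        refine (h v).trans ?_
        gcongr
        simpa using hv
    _ = _ := by rw [setLIntegral_const, mul_comm]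

theorem lintegral_volume_closedBall_sdiff_le {d : ℕ} {E : Set (EuclideanSpace ℝ (Fin d))}
    (hm : MeasurableSet E) (hfin : volume E ≠ ∞) (R : ℝ) :
    ∫⁻ x in E, volume (Metric.closedBall x R ∩ Eᶜ) ≤
      volume (Metric.closedBall (0 : EuclideanSpace ℝ (Fin d)) R) *
        (ENNReal.ofReal R * perimeter E) :=
  lintegral_volume_closedBall_inter_le hm.compl (volume_inter_translate_compl_le hm hfin) R

theorem lintegral_compl_volume_closedBall_inter_le {d : ℕ} {E : Set (EuclideanSpace ℝ (Fin d))}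
    (hm : MeasurableSet E) (hfin : volume E ≠ ∞) (R : ℝ) :
    ∫⁻ x in Eᶜ, volume (Metric.closedBall x R ∩ E) ≤
      volume (Metric.closedBall (0 : EuclideanSpace ℝ (Fin d)) R) *
        (ENNReal.ofReal R * perimeter E) := by
  refine lintegral_volume_closedBall_inter_le hm (fun v => ?_) R
  have : {x | x ∈ Eᶜ ∧ x + v ∈ E} = (fun x => x + v) ⁻¹' {x | x ∈ E ∧ x + -v ∈ Eᶜ} := by
    ext x
    simp [and_comm]
  rw [this, measure_preimage_add_right, ← norm_neg v]
  exact volume_inter_translate_compl_le hm hfin (-v)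

/-- A weak isoperimetric inequality: sets with a bounded ratio of perimeter to volume are not
small. -/
theorem volume_closedBall_le_two_mul {d : ℕ} {E : Set (EuclideanSpace ℝ (Fin d))}
    (hm : MeasurableSet E) (hfin : volume E ≠ ∞) (hpos : volume E ≠ 0) {C : ℝ≥0∞} {R : ℝ}
    (hC : perimeter E ≤ C * volume E) (hR : 2 * (ENNReal.ofReal R * C) ≤ 1) :
    volume (Metric.closedBall (0 : EuclideanSpace ℝ (Fin d)) R) ≤ 2 * volume E := by
  set b := volume (Metric.closedBall (0 : EuclideanSpace ℝ (Fin d)) R) with hb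
  have hbfin : b ≠ ∞ := measure_closedBall_lt_top.ne
  -- Wherever its centre, a ball of volume `b` has at least `b - |E|` of its volume outside `E`.
  have hlow : (b - volume E) * volume E ≤ ∫⁻ x in E, volume (Metric.closedBall x R ∩ Eᶜ) := by
    rw [← setLIntegral_const]
    refine lintegral_mono fun x => ?_
    have : b = volume (Metric.closedBall x R) := by
      rw [hb, Measure.addHaar_closedBall_center volume x]
    rw [this]
    exact le_measure_sdiff
  have h1 : (b - volume E) * volume E ≤ b * (ENNReal.ofReal R * C) * volume E := by
    refine (hlow.trans (lintegral_volume_closedBall_sdiff_le hm hfin R)).trans ?_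
    calc _ ≤ b * (ENNReal.ofReal R * (C * volume E)) := by gcongr
      _ = _ := by ring
  have h2 := tsub_le_iff_right.1 ((ENNReal.mul_le_mul_iff_left hpos hfin).1 h1)
  have h3 : b + b ≤ b + 2 * volume E := by
    calc b + b = 2 * b := (two_mul b).symm
      _ ≤ 2 * (b * (ENNReal.ofReal R * C) + volume E) := by gcongr
      _ = b * (2 * (ENNReal.ofReal R * C)) + 2 * volume E := by ring
      _ ≤ b * 1 + 2 * volume E := by gcongr
      _ = _ := by rw [mul_one]
  exact (ENNReal.add_le_add_iff_left hbfin).1 h3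

/-! ### Approximation by unions of grid cells -/

/-- The cell with index `k` of the cubic grid of step `r`. -/
def gridCell {d : ℕ} (r : ℝ) (k : Fin d → ℤ) : Set (EuclideanSpace ℝ (Fin d)) :=
  {y | ∀ i, ⌊y i / r⌋ = k i}

/-- The index of the grid cell that contains `x`. -/
noncomputable def gridIndex {d : ℕ} (r : ℝ) (x : EuclideanSpace ℝ (Fin d)) : Fin d → ℤ :=
  fun i => ⌊x i / r⌋

theorem gridCell_eq_preimage {d : ℕ} {r : ℝ} (hr : 0 < r) (k : Fin d → ℤ) :
    gridCell r k = WithLp.ofLp ⁻¹' (univ.pi fun i => Ico (k i * r) ((k i + 1) * r)) := by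
  ext y
  simp [gridCell, Int.floor_eq_iff, le_div_iff₀ hr, div_lt_iff₀ hr]

theorem volume_gridCell {d : ℕ} {r : ℝ} (hr : 0 < r) (k : Fin d → ℤ) :
    volume (gridCell r k) = ENNReal.ofReal r ^ d := by
  rw [gridCell_eq_preimage hr, (PiLp.volume_preserving_ofLp (Fin d)).measure_preimage
    (MeasurableSet.univ_pi fun i => measurableSet_Ico).nullMeasurableSet, Real.volume_pi_Ico]
  simp [add_mul]

theorem gridCell_subset_closedBall {d : ℕ} {r : ℝ} (hr : 0 < r)
    (x : EuclideanSpace ℝ (Fin d)) :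
    gridCell r (gridIndex r x) ⊆ Metric.closedBall x (√d * r) := by
  intro y hy
  rw [Metric.mem_closedBall, EuclideanSpace.dist_eq]
  have h : ∀ i, dist (y i) (x i) ^ 2 ≤ r ^ 2 := by
    intro i
    have h1 := Int.abs_sub_lt_one_of_floor_eq_floor (hy i)
    rw [← sub_div, abs_div, abs_of_pos hr, div_lt_one hr] at h1
    rw [Real.dist_eq]
    gcongr
  calc √(∑ i, dist (y i) (x i) ^ 2) ≤ √(∑ _i : Fin d, r ^ 2) :=
        Real.sqrt_le_sqrt (Finset.sum_le_sum fun i _ => h i)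
    _ = √d * r := by simp [Real.sqrt_sq hr.le]

theorem finite_gridIndex_image {d : ℕ} {Ω : Set (EuclideanSpace ℝ (Fin d))}
    (hb : Bornology.IsBounded Ω) {r : ℝ} (hr : 0 < r) : (gridIndex r '' Ω).Finite := by
  obtain ⟨B, hB⟩ := hb.exists_norm_le
  refine (finite_Icc (fun _ : Fin d => ⌊-B / r⌋) (fun _ => ⌊B / r⌋)).subset ?_
  rintro _ ⟨x, hx, rfl⟩
  have h : ∀ i, |x i| ≤ B := fun i => by
    simpa using (PiLp.norm_apply_le x i).trans (hB x hx)
  refine ⟨fun i => Int.floor_le_floor ?_, fun i => Int.floor_le_floor ?_⟩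
  · have := (abs_le.1 (h i)).1
    gcongr
  · have := (abs_le.1 (h i)).2
    gcongr

/-- The union of the grid cells more than half of which is covered by `E`. -/
def gridApprox {d : ℕ} (r : ℝ) (E : Set (EuclideanSpace ℝ (Fin d))) :
    Set (EuclideanSpace ℝ (Fin d)) :=
  {x | volume (gridCell r (gridIndex r x) \ E) ≤ ENNReal.ofReal r ^ d / 2}

/-- The constant in the estimate of the distance between a set and its grid approximation. -/
noncomputable def gridConst (d : ℕ) : ℝ≥0∞ :=
  4 * (volume (Metric.closedBall (0 : EuclideanSpace ℝ (Fin d)) 1) * ENNReal.ofReal √d ^ (d + 1))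

theorem gridConst_ne_top (d : ℕ) : gridConst d ≠ ∞ :=
  ENNReal.mul_ne_top (by simp) (ENNReal.mul_ne_top measure_closedBall_lt_top.ne (by simp))

/-- At a point of the symmetric difference, at least half of the cell lies on the other side of `E`,
and so does that much of the ball of radius `√d * r` around the point. Markov's inequality applies:
the averaged bound is of order `r ^ (d + 1)` and the threshold is `r ^ d / 2`, which leaves one
factor `r`. -/
theorem volume_symmDiff_gridApprox_le {d : ℕ} {E : Set (EuclideanSpace ℝ (Fin d))}
    (hm : MeasurableSet E) (hfin : volume E ≠ ∞) {r : ℝ} (hr : 0 < r) :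
    volume (E ∆ gridApprox r E) ≤ gridConst d * ENNReal.ofReal r * perimeter E := by
  set q := ENNReal.ofReal r ^ d with hq
  have hq0 : q ≠ 0 := by simp [hq, hr]
  have hqt : q ≠ ∞ := by simp [hq]
  have hq20 : q / 2 ≠ 0 := by simp [hq0]
  have hq2t : q / 2 ≠ ∞ := ENNReal.div_ne_top hqt (by simp)
  set R := √d * r with hR
  have hR0 : 0 ≤ R := by positivity
  set J := volume (Metric.closedBall (0 : EuclideanSpace ℝ (Fin d)) R) *
        (ENNReal.ofReal R * perimeter E) with hJ
  have hmeas : ∀ B : Set (EuclideanSpace ℝ (Fin d)), MeasurableSet B →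
      Measurable fun x => volume (Metric.closedBall x R ∩ B) := by
    intro B hB
    have : MeasurableSet {p : EuclideanSpace ℝ (Fin d) × EuclideanSpace ℝ (Fin d) |
        dist p.2 p.1 ≤ R ∧ p.2 ∈ B} :=
      (measurableSet_le (measurable_snd.dist measurable_fst) measurable_const).inter
        (hB.preimage measurable_snd)
    exact measurable_measure_prodMk_left this
  have markov : ∀ A B : Set (EuclideanSpace ℝ (Fin d)), MeasurableSet A → MeasurableSet B →
      ∫⁻ x in A, volume (Metric.closedBall x R ∩ B) ≤ J → ∀ S ⊆ A,
      (∀ x ∈ S, q / 2 ≤ volume (gridCell r (gridIndex r x) ∩ B)) → volume S ≤ J / (q / 2) := by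
    intro A B hA hB hle S hSA hS
    have h1 := meas_ge_le_lintegral_div (μ := volume.restrict A) (hmeas B hB).aemeasurable hq20 hq2t
    have h2 := h1.trans (ENNReal.div_le_div_right hle _)
    rw [Measure.restrict_apply (measurableSet_le measurable_const (hmeas B hB))] at h2
    refine (measure_mono ?_).trans h2
    exact fun x hx => ⟨(hS x hx).trans (measure_mono
      (inter_subset_inter_left _ (gridCell_subset_closedBall hr x))), hSA hx⟩
  have hE1 : volume (E \ gridApprox r E) ≤ J / (q / 2) :=
    markov E Eᶜ hm hm.compl (lintegral_volume_closedBall_sdiff_le hm hfin R) _ sdiff_subset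
      fun x hx => (not_le.1 hx.2).le
  have hE2 : volume (gridApprox r E \ E) ≤ J / (q / 2) := by
    refine markov Eᶜ E hm.compl hm (lintegral_compl_volume_closedBall_inter_le hm hfin R) _
      (fun x hx => hx.2) fun x hx => ?_
    have h1 := measure_inter_add_sdiff (μ := volume) (gridCell r (gridIndex r x)) hm
    rw [volume_gridCell hr] at h1
    have h2 : q / 2 + q / 2 ≤ volume (gridCell r (gridIndex r x) ∩ E) + q / 2 := by
      rw [ENNReal.add_halves]
      exact h1.ge.trans (add_le_add_right hx.1 _)
    exact (ENNReal.add_le_add_iff_right hq2t).1 h2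
  have hJq : J / (q / 2) + J / (q / 2) = gridConst d * ENNReal.ofReal r * perimeter E := by
    have hb : volume (Metric.closedBall (0 : EuclideanSpace ℝ (Fin d)) R) =
        ENNReal.ofReal √d ^ d * q *
          volume (Metric.closedBall (0 : EuclideanSpace ℝ (Fin d)) 1) := by
      rw [Measure.addHaar_closedBall' _ _ hR0, finrank_euclideanSpace_fin, hR,
        ENNReal.ofReal_pow (by positivity), ENNReal.ofReal_mul (by positivity), mul_pow]
    have hinv : (q / 2)⁻¹ = 2 * q⁻¹ := by
      rw [ENNReal.inv_div (by simp) (by simp), div_eq_mul_inv]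
    have hRr : ENNReal.ofReal R = ENNReal.ofReal √d * ENNReal.ofReal r :=
      ENNReal.ofReal_mul (by positivity)
    rw [div_eq_mul_inv, hinv, hJ, hb, hRr, gridConst]
    calc _ = 4 * (volume (Metric.closedBall (0 : EuclideanSpace ℝ (Fin d)) 1) *
          ENNReal.ofReal √d ^ (d + 1)) * ENNReal.ofReal r * perimeter E * (q * q⁻¹) := by ring
      _ = _ := by rw [ENNReal.mul_inv_cancel hq0 hqt, mul_one]
  calc volume (E ∆ gridApprox r E)
      ≤ volume (E \ gridApprox r E) + volume (gridApprox r E \ E) := measure_union_le _ _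
    _ ≤ J / (q / 2) + J / (q / 2) := add_le_add hE1 hE2
    _ = _ := hJq

/-! ### Compactness -/

/-- The measurable subsets of `Ω` of perimeter at most `M`. -/
def perimeterBoundedSets {d : ℕ} (Ω : Set (EuclideanSpace ℝ (Fin d))) (M : ℝ≥0) :
    Set (Set (EuclideanSpace ℝ (Fin d))) :=
  {E | MeasurableSet E ∧ E ⊆ Ω ∧ perimeter E ≤ M}

/-- The code `F E` records which of the finitely many cells meeting `Ω` are at least half filled by
`E`. It determines `gridApprox r E` inside `Ω`, so two sets with the same code are close to the same
set there. -/
theorem exists_finite_discretization {d : ℕ} {Ω : Set (EuclideanSpace ℝ (Fin d))}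
    (hb : Bornology.IsBounded Ω) (M : ℝ≥0) {ε : ℝ≥0∞} (hε : 0 < ε) :
    ∃ (β : Type) (_ : Finite β) (F : Set (EuclideanSpace ℝ (Fin d)) → β),
      ∀ E ∈ perimeterBoundedSets Ω M, ∀ E' ∈ perimeterBoundedSets Ω M, F E = F E' →
        volume (E ∆ E') < ε := by
  have hlim : Tendsto (fun r : ℝ => gridConst d * ENNReal.ofReal r * M +
      gridConst d * ENNReal.ofReal r * M) (𝓝[>] 0) (𝓝 0) := by
    have h1 : Tendsto (fun r : ℝ => gridConst d * ENNReal.ofReal r * M) (𝓝[>] 0) (𝓝 0) := by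
      have h0 : Tendsto (fun r : ℝ => ENNReal.ofReal r) (𝓝[>] 0) (𝓝 0) := by
        simpa using (ENNReal.tendsto_ofReal (tendsto_id (α := ℝ) (x := 𝓝 0))).mono_left
          nhdsWithin_le_nhds
      have := ENNReal.Tendsto.mul_const (b := (M : ℝ≥0∞))
        (ENNReal.Tendsto.const_mul (a := gridConst d) h0 (Or.inr (gridConst_ne_top d)))
        (Or.inr ENNReal.coe_ne_top)
      simpa using this
    simpa using h1.add h1
  obtain ⟨r, hrε, hr⟩ := ((hlim.eventually_lt_const hε).and self_mem_nhdsWithin).exists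
  have hr : 0 < r := hr
  have := (finite_gridIndex_image hb hr).to_subtype
  refine ⟨Set (gridIndex r '' Ω), inferInstance,
    fun E => {k | volume (gridCell r k.1 \ E) ≤ ENNReal.ofReal r ^ d / 2}, ?_⟩
  rintro E ⟨hm, hs, hP⟩ E' ⟨hm', hs', hP'⟩ hF
  have hfin : ∀ {A : Set (EuclideanSpace ℝ (Fin d))}, A ⊆ Ω → volume A ≠ ∞ := fun hA =>
    (hb.subset hA).measure_lt_top.ne
  have hiff : ∀ x ∈ Ω, (x ∈ gridApprox r E ↔ x ∈ gridApprox r E') := fun x hx =>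
    Set.ext_iff.1 hF ⟨gridIndex r x, mem_image_of_mem _ hx⟩
  have hsub : E ∆ E' ⊆ (E ∆ gridApprox r E) ∪ (E' ∆ gridApprox r E') := by
    intro x hx
    have hxΩ : x ∈ Ω := hx.elim (fun h => hs h.1) fun h => hs' h.1
    have := hiff x hxΩ
    simp only [mem_union, mem_symmDiff] at hx ⊢
    tauto
  calc volume (E ∆ E') ≤ _ := (measure_mono hsub).trans (measure_union_le _ _)
    _ ≤ gridConst d * ENNReal.ofReal r * M + gridConst d * ENNReal.ofReal r * M := by
        gcongr
        · exact (volume_symmDiff_gridApprox_le hm (hfin hs) hr).trans (by gcongr)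
        · exact (volume_symmDiff_gridApprox_le hm' (hfin hs') hr).trans (by gcongr)
    _ < ε := hrε

/-- Compactness of sets of bounded perimeter, for finitely many sequences at once. -/
theorem exists_subseq_tendsto_symmDiff {d : ℕ} {ι : Type*} [Finite ι]
    {Ω : Set (EuclideanSpace ℝ (Fin d))} (hb : Bornology.IsBounded Ω) {M : ℝ≥0}
    {u : ℕ → ι → Set (EuclideanSpace ℝ (Fin d))}
    (hu : ∀ n i, u n i ∈ perimeterBoundedSets Ω M) :
    ∃ φ : ℕ → ℕ, StrictMono φ ∧ ∃ F : ι → Set (EuclideanSpace ℝ (Fin d)),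
      (∀ i, MeasurableSet (F i)) ∧
        ∀ i, Tendsto (fun n => volume (u (φ n) i ∆ F i)) atTop (𝓝 0) := by
  have hfin : ∀ E : perimeterBoundedSets Ω M, volume E.1 ≠ ∞ := fun E =>
    (hb.subset E.2.2.1).measure_lt_top.ne
  let f : perimeterBoundedSets Ω M → Lp ℝ 1 (volume : Measure (EuclideanSpace ℝ (Fin d))) :=
    fun E => indicatorConstLp 1 E.2.1 (hfin E) 1
  have htb : TotallyBounded (range f) := by
    refine Metric.totallyBounded_of_finite_discretization fun ε hε => ?_
    obtain ⟨β, hβ, F, hF⟩ := exists_finite_discretization hb M (ENNReal.ofReal_pos.2 hε)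
    refine ⟨β, Fintype.ofFinite β, fun x => F x.2.choose.1, ?_⟩
    intro x y hxy
    have h := hF _ x.2.choose.2 _ y.2.choose.2 hxy
    rw [← x.2.choose_spec, ← y.2.choose_spec, dist_indicatorConstLp_eq_norm,
      norm_indicatorConstLp one_ne_zero ENNReal.one_ne_top]
    simpa [Measure.real] using (ENNReal.lt_ofReal_iff_toReal_lt h.ne_top).1 h
  -- Compactness of the product yields one subsequence that serves all indices.
  have hK : IsCompact (univ.pi fun _ : ι => closure (range f)) :=
    isCompact_univ_pi fun _ => htb.closure.isCompact_of_isClosed isClosed_closure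
  obtain ⟨g, -, φ, hφ, hg⟩ := hK.tendsto_subseq (x := fun n i => f ⟨u n i, hu n i⟩)
    fun n i _ => subset_closure (mem_range_self _)
  -- The `L¹` limit need not be shown to be an indicator: where its superlevel set at `1 / 2`
  -- differs from `u (φ n) i`, the limit is at least `1 / 2` away from the indicator, so convergence
  -- in measure suffices.
  refine ⟨φ, hφ, fun i => {x | 1 / 2 < g i x}, fun i => ?_, fun i => ?_⟩
  · exact measurableSet_lt measurable_const (Lp.stronglyMeasurable (g i)).measurable
  · have h1 := (tendstoInMeasure_of_tendsto_Lp (tendsto_pi_nhds.1 hg i))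
      (ENNReal.ofReal (1 / 2)) (by simp)
    refine tendsto_of_tendsto_of_tendsto_of_le_of_le tendsto_const_nhds h1
      (fun _ => zero_le) fun n => measure_mono_ae ?_
    filter_upwards [indicatorConstLp_coeFn (p := 1) (hs := (hu (φ n) i).1)
      (hμs := hfin ⟨_, hu (φ n) i⟩) (c := (1 : ℝ))] with x hx hxs
    have hx' : (f ⟨u (φ n) i, hu (φ n) i⟩ : EuclideanSpace ℝ (Fin d) → ℝ) x =
      (u (φ n) i).indicator (fun _ => 1) x := hx
    change ENNReal.ofReal (1 / 2) ≤ edist ((f ⟨u (φ n) i, hu (φ n) i⟩ : _ → ℝ) x) (g i x)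
    rw [hx', edist_dist, Real.dist_eq]
    refine ENNReal.ofReal_le_ofReal ?_
    rcases hxs with ⟨h1, h2⟩ | ⟨h1, h2⟩
    · rw [indicator_of_mem h1]
      have : g i x ≤ 1 / 2 := not_lt.1 h2
      exact le_trans (by linarith) (le_abs_self _)
    · rw [indicator_of_notMem h2]
      have : 1 / 2 < g i x := h1
      exact le_trans (by linarith) (neg_le_abs _)

/-! ### Existence of clusters -/

/-- By the divergence theorem, `∫ div T` is a sum of face integrals of components of `T`, each at
most the area of its face; `C` is the total area of the faces. -/
theorem perimeter_preimage_Icc_lt_top {n : ℕ} {a b : Fin (n + 1) → ℝ} (hab : a ≤ b) :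
    perimeter (WithLp.ofLp ⁻¹' Icc a b : Set (EuclideanSpace ℝ (Fin (n + 1)))) < ∞ := by
  set C : ℝ := ∑ i : Fin (n + 1),
    (volume.real (Icc (a ∘ i.succAbove) (b ∘ i.succAbove)) +
      volume.real (Icc (a ∘ i.succAbove) (b ∘ i.succAbove))) with hC
  refine lt_of_le_of_lt (iSup₂_le fun T hT => ENNReal.ofReal_le_ofReal ?_)
    (ENNReal.ofReal_lt_top (r := C))
  let e := (PiLp.continuousLinearEquiv 2 ℝ (fun _ : Fin (n + 1) => ℝ)).symm
  have he : ∀ y, e y = WithLp.toLp 2 y := fun y => rfl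
  let π : Fin (n + 1) → EuclideanSpace ℝ (Fin (n + 1)) →L[ℝ] ℝ := fun i => EuclideanSpace.proj i
  have hdiv : ∀ y, divergence T (WithLp.toLp 2 y) = ∑ i, ((π i).comp
      ((fderiv ℝ T (e y)).comp (e : (Fin (n + 1) → ℝ) →L[ℝ] _))) (Pi.single i 1) := by
    intro y
    simp [divergence, π, he]
  have hTc : Continuous fun y => T (e y) := hT.contDiff.continuous.comp e.continuous
  have h1 : ∫ x in WithLp.ofLp ⁻¹' Icc a b, divergence T x =
      ∫ y in Icc a b, divergence T (WithLp.toLp 2 y) := by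
    have := (PiLp.volume_preserving_ofLp (Fin (n + 1))).setIntegral_preimage_emb
      (MeasurableEquiv.toLp 2 (Fin (n + 1) → ℝ)).symm.measurableEmbedding
      (fun y => divergence T (WithLp.toLp 2 y)) (Icc a b)
    simpa using this
  have h2 := integral_divergence_of_hasFDerivAt_off_countable' a b hab
    (fun i y => T (e y) i) (fun i y => (π i).comp
      ((fderiv ℝ T (e y)).comp (e : (Fin (n + 1) → ℝ) →L[ℝ] _))) ∅ countable_empty
    (fun i => ((π i).continuous.comp hTc).continuousOn)
    (fun x _ i => (π i).hasFDerivAt.comp x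
      (((hT.contDiff.differentiable one_ne_zero _).hasFDerivAt).comp x e.hasFDerivAt)) (by
      simp_rw [← hdiv]
      exact ((continuous_divergence hT.contDiff).comp e.continuous).continuousOn.integrableOn_compact
        isCompact_Icc)
  rw [h1]
  simp_rw [hdiv]
  rw [h2]
  refine Finset.sum_le_sum fun i _ => ?_
  have hbound : ∀ g : (Fin n → ℝ) → (Fin (n + 1) → ℝ),
      |∫ x in Icc (a ∘ i.succAbove) (b ∘ i.succAbove), T (e (g x)) i| ≤
        volume.real (Icc (a ∘ i.succAbove) (b ∘ i.succAbove)) := by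
    intro g
    have := norm_setIntegral_le_of_norm_le_const (μ := volume)
      (s := Icc (a ∘ i.succAbove) (b ∘ i.succAbove))
      (f := fun x => T (e (g x)) i) (C := 1) isCompact_Icc.measure_lt_top
      fun x _ => (PiLp.norm_apply_le _ i).trans (hT.norm_le_one _)
    simpa using this
  exact (sub_le_sub (abs_le.1 (hbound _)).2 (abs_le.1 (hbound _)).1).trans_eq
    (sub_neg_eq_add _ _)

/-- Every neighbourhood of a point contains a box of positive volume and finite perimeter. -/
theorem exists_box_subset {n : ℕ} {U : Set (EuclideanSpace ℝ (Fin (n + 1)))}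
    {p : EuclideanSpace ℝ (Fin (n + 1))} (hU : U ∈ 𝓝 p) :
    ∃ B ⊆ U, MeasurableSet B ∧ 0 < volume B ∧ perimeter B < ∞ := by
  have h1 : WithLp.toLp 2 ⁻¹' U ∈ 𝓝 (WithLp.ofLp p) :=
    (PiLp.continuous_toLp 2 _).continuousAt.preimage_mem_nhds hU
  obtain ⟨ε, hε, hεU⟩ := Metric.nhds_basis_closedBall.mem_iff.1 h1
  have hm : MeasurableSet (Icc (fun i => p i - ε) (fun i => p i + ε)) := measurableSet_Icc
  refine ⟨WithLp.ofLp ⁻¹' Icc (fun i => p i - ε) (fun i => p i + ε), fun x hx => ?_,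
    (PiLp.volume_preserving_ofLp (Fin (n + 1))).measurable hm, ?_,
    perimeter_preimage_Icc_lt_top fun i => by dsimp only; linarith⟩
  · have : WithLp.ofLp x ∈ Metric.closedBall (WithLp.ofLp p) ε := by
      refine (dist_pi_le_iff hε.le).2 fun i => abs_le.2 ⟨?_, ?_⟩
      · linarith [hx.1 i]
      · linarith [hx.2 i]
    exact hεU this
  · rw [(PiLp.volume_preserving_ofLp (Fin (n + 1))).measure_preimage hm.nullMeasurableSet,
      Real.volume_Icc_pi]
    refine Finset.prod_induction _ (fun x => 0 < x) (fun _ _ h h' => ENNReal.mul_pos h.ne' h'.ne')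
      zero_lt_one fun i _ => ENNReal.ofReal_pos.2 (by linarith)

/-- This makes the Cheeger constant finite. As `d ≥ 1`, the open set `Ω` is infinite; small boxes
around `N` of its points, inside disjoint neighbourhoods, form a cluster. -/
theorem exists_isNCluster {d : ℕ} (hd : 1 ≤ d) (N : ℕ) {Ω : Set (EuclideanSpace ℝ (Fin d))}
    (hopen : IsOpen Ω) (hne : Ω.Nonempty) :
    ∃ E : Fin N → Set (EuclideanSpace ℝ (Fin d)), IsNCluster E Ω := by
  obtain ⟨n, rfl⟩ := Nat.exists_eq_add_of_le' hd
  obtain ⟨x, hx⟩ := hne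
  have : (𝓝[≠] x).NeBot := Module.punctured_nhds_neBot ℝ _ x
  have hinf : Ω.Infinite := infinite_of_mem_nhds x (hopen.mem_nhds hx)
  have := hinf.to_subtype
  let p : Fin N → EuclideanSpace ℝ (Fin (n + 1)) := fun i => (Infinite.natEmbedding Ω i).1
  have hp : Function.Injective p := Subtype.val_injective.comp
    ((Infinite.natEmbedding Ω).injective.comp Fin.val_injective)
  obtain ⟨U, hU, hdisj⟩ := (finite_range p).t2_separation
  have hbox : ∀ i, ∃ B ⊆ U (p i) ∩ Ω, MeasurableSet B ∧ 0 < volume B ∧ perimeter B < ∞ :=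
    fun i => exists_box_subset (p := p i) (inter_mem ((hU _).2.mem_nhds (hU _).1)
      (hopen.mem_nhds (Infinite.natEmbedding Ω i).2))
  choose B hBU hBm hBpos hBP using hbox
  refine ⟨B, ⟨⟨fun i => (hBm i).nullMeasurableSet, fun i => ?_, hBpos, fun i j hij => ?_⟩, hBP⟩⟩
  · rw [sdiff_eq_empty.2 ((hBU i).trans inter_subset_right), measure_empty]
  · have := (hdisj (mem_range_self i) (mem_range_self j) (hp.ne hij)).mono
      ((hBU i).trans inter_subset_left) ((hBU j).trans inter_subset_left)
    rw [this.inter_eq, measure_empty]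

/-! ### Semicontinuity of perimeter and continuity of volume -/

theorem IsTestField.tendsto_setIntegral_divergence {d : ℕ}
    {T : EuclideanSpace ℝ (Fin d) → EuclideanSpace ℝ (Fin d)} (hT : IsTestField T)
    {u : ℕ → Set (EuclideanSpace ℝ (Fin d))} {F : Set (EuclideanSpace ℝ (Fin d))}
    (hu : ∀ n, MeasurableSet (u n)) (hF : MeasurableSet F)
    (h : Tendsto (fun n => volume (u n ∆ F)) atTop (𝓝 0)) :
    Tendsto (fun n => ∫ x in u n, divergence T x) atTop (𝓝 (∫ x in F, divergence T x)) := by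
  have hc := continuous_divergence hT.contDiff
  have hs := hasCompactSupport_divergence hT.hasCompactSupport
  have hint : Integrable (divergence T) := hc.integrable_of_hasCompactSupport hs
  obtain ⟨C, hC⟩ := hs.exists_bound_of_continuous hc
  have hreal : Tendsto (fun n => C * volume.real (u n ∆ F)) atTop (𝓝 0) := by
    simpa [Measure.real] using ((ENNReal.tendsto_toReal ENNReal.zero_ne_top).comp h).const_mul C
  rw [tendsto_iff_dist_tendsto_zero]
  refine tendsto_of_tendsto_of_tendsto_of_le_of_le' tendsto_const_nhds hreal
    (Eventually.of_forall fun _ => dist_nonneg) ?_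
  filter_upwards [h.eventually_lt_const ENNReal.zero_lt_top] with n hn
  rw [dist_eq_norm, ← integral_indicator (hu n), ← integral_indicator hF,
    ← integral_sub (hint.indicator (hu n)) (hint.indicator hF)]
  have hpt : (fun x => (u n).indicator (divergence T) x - F.indicator (divergence T) x) =
      (u n ∆ F).indicator
        (fun x => (u n).indicator (divergence T) x - F.indicator (divergence T) x) := by
    ext x
    by_cases h1 : x ∈ u n <;> by_cases h2 : x ∈ F <;> simp [h1, h2, mem_symmDiff, indicator]
  rw [hpt, integral_indicator ((hu n).symmDiff hF)]
  refine norm_setIntegral_le_of_norm_le_const hn fun x hx => ?_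
  rcases hx with ⟨h1, h2⟩ | ⟨h1, h2⟩ <;> simpa [h1, h2] using hC x

/-- Perimeter is a supremum of functionals continuous under convergence in measure, hence lower
semicontinuous. The majorants `p n` will be ratio times volume. -/
theorem perimeter_le_of_tendsto {d : ℕ} {u : ℕ → Set (EuclideanSpace ℝ (Fin d))}
    {F : Set (EuclideanSpace ℝ (Fin d))} (hu : ∀ n, MeasurableSet (u n)) (hF : MeasurableSet F)
    (h : Tendsto (fun n => volume (u n ∆ F)) atTop (𝓝 0)) {p : ℕ → ℝ≥0∞} {q : ℝ≥0∞}
    (hp : Tendsto p atTop (𝓝 q)) (hle : ∀ n, perimeter (u n) ≤ p n) : perimeter F ≤ q :=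
  iSup₂_le fun _ hT => le_of_tendsto_of_tendsto'
    (ENNReal.tendsto_ofReal (hT.tendsto_setIntegral_divergence hu hF h)) hp
    fun n => (hT.ofReal_integral_le (u n)).trans (hle n)

theorem tendsto_volume_of_symmDiff {d : ℕ} {u : ℕ → Set (EuclideanSpace ℝ (Fin d))}
    {F : Set (EuclideanSpace ℝ (Fin d))} (hu : ∀ n, MeasurableSet (u n)) (hF : MeasurableSet F)
    (h : Tendsto (fun n => volume (u n ∆ F)) atTop (𝓝 0)) :
    Tendsto (fun n => volume (u n)) atTop (𝓝 (volume F)) := by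
  let s : ℕ → MeasuredSets (volume : Measure (EuclideanSpace ℝ (Fin d))) := fun n => ⟨u n, hu n⟩
  let t : MeasuredSets (volume : Measure (EuclideanSpace ℝ (Fin d))) := ⟨F, hF⟩
  have : Tendsto s atTop (𝓝 t) := tendsto_iff_edist_tendsto_0.2 h
  exact (MeasuredSets.continuous_measure.tendsto t).comp this

/-! ### Limits of clusters -/

/-- Perimeter and volume ignore null sets, so clusters may be taken measurable and truly inside `Ω`,
as the compactness argument requires. -/
theorem IsNCluster.exists_measurableSet_subset {d N : ℕ}
    {E : Fin N → Set (EuclideanSpace ℝ (Fin d))} {Ω : Set (EuclideanSpace ℝ (Fin d))}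
    (hE : IsNCluster E Ω) (hΩ : MeasurableSet Ω) :
    ∃ E' : Fin N → Set (EuclideanSpace ℝ (Fin d)), (∀ i, MeasurableSet (E' i)) ∧
      (∀ i, E' i ⊆ Ω) ∧ IsNCluster E' Ω ∧ ratios E' = ratios E := by
  choose t ht hm hae using fun i => (hE.nullMeasurableSet i).exists_measurable_subset_ae_eq
  have hae' : ∀ i, (t i ∩ Ω : Set _) =ᵐ[volume] E i := fun i => by
    have h1 : (E i ∩ Ω : Set _) =ᵐ[volume] E i :=
      ae_eq_set.2 ⟨by simp [sdiff_eq_empty.2 inter_subset_left], by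
        rw [sdiff_self_inter]; exact hE.subset i⟩
    exact ((hae i).inter (ae_eq_refl Ω)).trans h1
  have hm' : ∀ i, MeasurableSet (t i ∩ Ω) := fun i => (hm i).inter hΩ
  refine ⟨fun i => t i ∩ Ω, hm', fun i => inter_subset_right,
    ⟨⟨fun i => (hm' i).nullMeasurableSet, fun i => ?_, fun i => ?_, fun i j hij => ?_⟩,
      fun i => ?_⟩, ?_⟩
  · rw [sdiff_eq_empty.2 inter_subset_right, measure_empty]
  · rw [measure_congr (hae' i)]
    exact hE.volume_pos i
  · rw [measure_congr ((hae' i).inter (hae' j))]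
    exact hE.disjoint i j hij
  · rw [perimeter_congr_ae (hae' i)]
    exact hE.perimeter_lt_top i
  · ext i
    simp only [ratios, perimeter_congr_ae (hae' i), measure_congr (hae' i)]

theorem IsNCluster.ratios_mul_volume {d N : ℕ} {E : Fin N → Set (EuclideanSpace ℝ (Fin d))}
    {Ω : Set (EuclideanSpace ℝ (Fin d))} (hE : IsNCluster E Ω) {i : Fin N}
    (hfin : volume (E i) ≠ ∞) : ratios E i * volume (E i) = perimeter (E i) := by
  have h0 := (hE.volume_pos i).ne'
  rw [ratios, ENNReal.coe_toNNReal (ENNReal.div_ne_top (hE.perimeter_lt_top i).ne h0),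
    ENNReal.div_mul_cancel h0 hfin]

/-- The limit of a sequence of clusters with convergent ratios is a cluster, whose ratios are at
most the limits. -/
theorem exists_isNCluster_ratios_le {d N : ℕ} {Ω : Set (EuclideanSpace ℝ (Fin d))}
    (hb : Bornology.IsBounded Ω) {w : ℕ → Fin N → Set (EuclideanSpace ℝ (Fin d))}
    (hm : ∀ n i, MeasurableSet (w n i)) (hs : ∀ n i, w n i ⊆ Ω) (hw : ∀ n, IsNCluster (w n) Ω)
    {C : ℝ≥0} (hC : ∀ n i, ratios (w n) i ≤ C) {v : Fin N → ℝ≥0}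
    (hv : Tendsto (fun n => ratios (w n)) atTop (𝓝 v)) :
    ∃ F : Fin N → Set (EuclideanSpace ℝ (Fin d)), IsNCluster F Ω ∧ ratios F ≤ v := by
  have hΩfin : volume Ω ≠ ∞ := hb.measure_lt_top.ne
  have hfin : ∀ n i, volume (w n i) ≠ ∞ := fun n i => measure_ne_top_of_subset (hs n i) hΩfin
  have hP : ∀ n i, perimeter (w n i) ≤ C * volume (w n i) := fun n i => by
    rw [← (hw n).ratios_mul_volume (hfin n i)]
    gcongr
    exact hC n i
  obtain ⟨φ, hφ, F, hF, hlim⟩ := exists_subseq_tendsto_symmDiff (u := w) hb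
    (M := C * (volume Ω).toNNReal) fun n i => ⟨hm n i, hs n i, by
      rw [ENNReal.coe_mul, ENNReal.coe_toNNReal hΩfin]
      exact (hP n i).trans (by gcongr; exact hs n i)⟩
  have hvol : ∀ i, Tendsto (fun n => volume (w (φ n) i)) atTop (𝓝 (volume (F i))) := fun i =>
    tendsto_volume_of_symmDiff (fun n => hm (φ n) i) (hF i) (hlim i)
  have hFfin : ∀ i, volume (F i) ≠ ∞ := fun i => ne_top_of_le_ne_top hΩfin
    (le_of_tendsto' (hvol i) fun n => measure_mono (hs (φ n) i))
  have hFpos : ∀ i, 0 < volume (F i) := fun i => by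
    -- A radius with `2 R C ≤ 1`, common to all `n`; the `+ 1` keeps it positive when `C = 0`.
    set R : ℝ := (2 * (C + 1 : ℝ))⁻¹ with hR
    have hR0 : 0 < R := by positivity
    have hRC : 2 * (ENNReal.ofReal R * C) ≤ 1 := by
      rw [← ENNReal.ofReal_coe_nnreal, ← ENNReal.ofReal_mul hR0.le,
        ← ENNReal.ofReal_ofNat 2, ← ENNReal.ofReal_mul zero_le_two, ENNReal.ofReal_le_one, hR,
        mul_inv, ← mul_assoc, ← mul_assoc, mul_inv_cancel₀ two_ne_zero, one_mul,
        inv_mul_le_iff₀ (by positivity)]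
      linarith
    have h1 : volume (Metric.closedBall (0 : EuclideanSpace ℝ (Fin d)) R) ≤ 2 * volume (F i) :=
      ge_of_tendsto' (ENNReal.Tendsto.const_mul (hvol i) (Or.inr (by simp))) fun n =>
        volume_closedBall_le_two_mul (hm _ i) (hfin _ i) ((hw _).volume_pos i).ne' (hP _ i) hRC
    have h2 := (Metric.measure_closedBall_pos volume (0 : EuclideanSpace ℝ (Fin d)) hR0).trans_le h1
    exact pos_iff_ne_zero.2 fun h => by simp [h] at h2
  have hFP : ∀ i, perimeter (F i) ≤ v i * volume (F i) := fun i => by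
    refine perimeter_le_of_tendsto (fun n => hm (φ n) i) (hF i) (hlim i)
      (p := fun n => ratios (w (φ n)) i * volume (w (φ n) i)) ?_
      fun n => ((hw _).ratios_mul_volume (hfin _ i)).ge
    exact ENNReal.Tendsto.mul
      (ENNReal.tendsto_coe.2 ((tendsto_pi_nhds.1 hv i).comp hφ.tendsto_atTop))
      (Or.inr (hFfin i)) (hvol i) (Or.inr ENNReal.coe_ne_top)
  refine ⟨F, ⟨⟨fun i => (hF i).nullMeasurableSet, fun i => ?_, hFpos, fun i j hij => ?_⟩,
    fun i => (hFP i).trans_lt (ENNReal.mul_lt_top ENNReal.coe_lt_top (hFfin i).lt_top)⟩,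
    fun i => ?_⟩
  · refine le_antisymm (ge_of_tendsto' (hlim i) fun n => measure_mono ?_) zero_le
    exact fun x hx => Or.inr ⟨hx.1, fun h => hx.2 (hs _ i h)⟩
  · have h0 := (hlim i).add (hlim j)
    rw [add_zero] at h0
    refine le_antisymm (ge_of_tendsto' h0 fun n => ?_) zero_le
    have hsub : F i ∩ F j ⊆
        (w (φ n) i ∩ w (φ n) j) ∪ (w (φ n) i ∆ F i ∪ w (φ n) j ∆ F j) := by
      intro x hx
      simp only [mem_union, mem_inter_iff, mem_symmDiff] at hx ⊢
      tauto
    refine (measure_mono hsub).trans ((measure_union_le _ _).trans ?_)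
    rw [(hw (φ n)).disjoint i j hij, zero_add]
    exact measure_union_le _ _
  · exact ENNReal.toNNReal_mono ENNReal.coe_ne_top (ENNReal.div_le_of_le_mul (hFP i))

end NCheeger

/-! ### The direct method -/

theorem mainTheorem1 (d N : ℕ) (hd : 1 ≤ d)
    (Φ : (Fin N → ℝ≥0) → ℝ≥0)
    (hlsc : LowerSemicontinuous Φ) (hcoer : NCheeger.Coercive Φ) (hmono : Monotone Φ)
    (Ω : Set (EuclideanSpace ℝ (Fin d)))
    (hopen : IsOpen Ω) (hbdd : Bornology.IsBounded Ω) (hne : Ω.Nonempty) :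
    ∃ E : Fin N → Set (EuclideanSpace ℝ (Fin d)), NCheeger.IsCheegerNCluster Φ E Ω := by
  set H := NCheeger.cheegerConstant Φ Ω with hHdef
  have hHle : ∀ E, NCheeger.IsNCluster E Ω → H ≤ Φ (NCheeger.ratios E) := fun E hE =>
    iInf₂_le (f := fun E (_ : NCheeger.IsNCluster E Ω) => (Φ (NCheeger.ratios E) : ℝ≥0∞)) E hE
  have hH : H ≠ ∞ := by
    obtain ⟨E, hE⟩ := NCheeger.exists_isNCluster hd N hopen hne
    exact ne_top_of_le_ne_top ENNReal.coe_ne_top (hHle E hE)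
  have hseq : ∀ n : ℕ, ∃ E : Fin N → Set (EuclideanSpace ℝ (Fin d)),
      (∀ i, MeasurableSet (E i)) ∧ (∀ i, E i ⊆ Ω) ∧ NCheeger.IsNCluster E Ω ∧
        (Φ (NCheeger.ratios E) : ℝ≥0∞) < H + ((n : ℝ≥0∞) + 1)⁻¹ := by
    intro n
    have h1 : H < H + ((n : ℝ≥0∞) + 1)⁻¹ := ENNReal.lt_add_right hH (by simp)
    obtain ⟨E, hE⟩ := iInf_lt_iff.1 h1
    obtain ⟨hE, hlt⟩ := iInf_lt_iff.1 hE
    obtain ⟨E', hm, hs, hE', hr⟩ := hE.exists_measurableSet_subset hopen.measurableSet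
    exact ⟨E', hm, hs, hE', hr ▸ hlt⟩
  choose u hm hs hu hlt using hseq
  obtain ⟨δ, hδ, hcoer⟩ := hcoer
  -- Along the sequence `Φ` is at most `H + 1`, so coercivity bounds each ratio by `(H + 1) / δ`.
  set C : ℝ≥0 := (H.toNNReal + 1) / δ with hC
  have hbound : ∀ n i, NCheeger.ratios (u n) i ≤ C := by
    intro n i
    have h1 : (Φ (NCheeger.ratios (u n)) : ℝ≥0∞) ≤ (H.toNNReal + 1 : ℝ≥0) := by
      rw [ENNReal.coe_add, ENNReal.coe_toNNReal hH, ENNReal.coe_one]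
      exact (hlt n).le.trans (by gcongr; simp)
    rw [hC, le_div_iff₀ hδ, mul_comm]
    refine le_trans ?_ ((hcoer _).trans (ENNReal.coe_le_coe.1 h1))
    gcongr
    exact Finset.single_le_sum (fun _ _ => zero_le) (Finset.mem_univ i)
  obtain ⟨v, -, ψ, hψ, hv⟩ := (isCompact_Icc (a := (0 : Fin N → ℝ≥0)) (b := fun _ => C)).tendsto_subseq
    (x := fun n => NCheeger.ratios (u n)) fun n => ⟨fun _ => zero_le, hbound n⟩
  obtain ⟨F, hF, hFv⟩ := NCheeger.exists_isNCluster_ratios_le hbdd (w := fun n => u (ψ n))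
    (fun n => hm _) (fun n => hs _) (fun n => hu _) (fun n => hbound _) hv
  refine ⟨F, hF, le_antisymm ?_ (hHle F hF)⟩
  refine (ENNReal.coe_le_coe.2 (hmono hFv)).trans (le_of_forall_lt fun y hy => ?_)
  lift y to ℝ≥0 using hy.ne_top
  -- Passing to the limit only gives `z ≤ H`; the intermediate `z` restores the strict inequality `y
  -- < H`.
  obtain ⟨z, hyz, hz⟩ := exists_between (ENNReal.coe_lt_coe.1 hy)
  refine (ENNReal.coe_lt_coe.2 hyz).trans_le ?_
  have hlim : Tendsto (fun n : ℕ => H + (((ψ n : ℕ) : ℝ≥0∞) + 1)⁻¹) atTop (𝓝 H) := by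
    have h0 : Tendsto (fun n : ℕ => ((n : ℝ≥0∞) + 1)⁻¹) atTop (𝓝 0) := by
      simpa using (tendsto_add_atTop_iff_nat 1).2 ENNReal.tendsto_inv_nat_nhds_zero
    simpa using (h0.comp hψ.tendsto_atTop).const_add H
  refine ge_of_tendsto hlim ?_
  filter_upwards [hv.eventually (hlsc v z hz)] with n hn
  exact (ENNReal.coe_lt_coe.2 hn).le.trans (hlt (ψ n)).le
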